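/- Let $p:[0,1]\to(1,\infty)$ be measurable. For a measurable $f:[0,1]\to\mathbb R$ and $a>0$ let $\varphi_{f,a}$ be the absolutely continuous (Carathéodory) solution on $[0,1]$ of $$\varphi(0)=a,\qquad \varphi'(t)=\frac{|f(t)|^{p(t)}}{p(t)}\,\varphi(t)^{1-p(t)}\quad\text{for a.e. }t .$$ Let $L^{p(\cdot)}$ be the class of those $f$ (modulo a.e. equality) for which $\varphi_{f,a}$ exists for every $a>0$ and the pointwise limit $\varphi_f=\lim_{a\searrow0}\varphi_{f,a}$ is an absolutely continuous solution with $\varphi_f(0)=0$ (the right-hand side being read as $0$ where $f=0$), and put $\|f\|_{p(\cdot)}=\varphi_f(1)$. Assume that $L^{p(\cdot)}$, with the pointwise operations and $\|\cdot\|_{p(\cdot)}$, is a Banach space and that $C[0,1]\subset L^{p(\cdot)}$, and let $X$ be the closure of $C[0,1]$ in $L^{p(\cdot)}$. For $g:[0,1]\to\mathbb R$ of bounded variation let $m_g$ be the Lebesgue–Stieltjes (signed) measure on $[0,1]$ induced by $g$, that is, $m_g((a,b])=g(b+)-g(a+)$ and $m_g(\{0\})=g(0+)-g(0)$ (with $g(1+)=g(1)$),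 and let $$\bigvee_{p(\cdot)^*}m_g=\sup\Big\{\int_0^1 f\,dm_g:\ f\in C[0,1],\ \|f\|_{p(\cdot)}\le1\Big\}\in[0,\infty].$$ **Theorem 2.2.** For every $t\in[0,1]$ the indicator $1_{[0,t]}$ belongs to $X$. For every $F\in X^*$ the function $g_F(t)=F(1_{[0,t]})$ has bounded variation, and $F\mapsto m_{g_F}$ is a linear bijection from $X^*$ onto the set of all Lebesgue–Stieltjes measures $m_g$ with $\bigvee_{p(\cdot)^*}m_g<\infty$. Moreover $$\|F\|_{X^*}=\bigvee_{p(\cdot)^*}m_{g_F}\quad\text{for all }F\in X^*,$$ and the duality is given by $F(x)=\int_0^1x\,dm_{g_F}$ for $x\in X$, in the following sense: for $x\in C[0,1]$ it holds with the continuous function $x$ itself, and every class $x\in X$ has a Borel representative $\tilde x$ (equal to $x$ Lebesgue-a.e. and depending only on $x$) such that, for every $F\in X^*$, $\tilde x$ is $|m_{g_F}|$-integrable and $F(x)=\int_0^1\tilde x\,dm_{g_F}$. -/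

import Mathlib

open MeasureTheory Set Filter Topology
open scoped unitInterval ENNReal

namespace OdeNorm

/-- `L⁰[0,1]`: classes of Lebesgue measurable real functions on `[0,1]` modulo a.e. equality. -/
abbrev L0 : Type := I →ₘ[(volume : Measure I)] ℝ

/-- The right-hand side `|f(t)|^{p(t)} / p(t) * φ(t)^{1 - p(t)}` of the norm-determining ODE. -/
noncomputable def field (p f φ : I → ℝ) (t : I) : ℝ :=
  |f t| ^ p t / p t * φ t ^ (1 - p t)

/-- Weak (Carathéodory) solutions on `[0,1]` of
`φ(0) = a`, `φ'(t) = |f(t)|^{p(t)} / p(t) * φ(t)^{1 - p(t)}`. -/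
structure IsWeakSolution (p f : I → ℝ) (a : ℝ) (φ : I → ℝ) : Prop where
  absolutelyContinuous : AbsolutelyContinuousOnInterval (IccExtend zero_le_one φ) 0 1
  integrable : Integrable (field p f φ) volume
  eq_integral : ∀ T : I, φ T = a + ∫ t in Iic T, field p f φ t

/-- The stabilized solution, with initial value `φ(0) = 0⁺`: the ODE has a solution for every
positive initial value `a`, these solutions converge pointwise to `φ` as `a ↘ 0`, and `φ` is again
a weak solution. (For the limit `φ` one has `f = 0` a.e. on `{φ = 0}`, and there the right-hand
side is `0`, in accordance with Lean's `0 ^ (1 - p) = 0` for `p ≠ 1`.) -/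
def IsNormSolution (p f φ : I → ℝ) : Prop :=
  IsWeakSolution p f 0 φ ∧
    ∃ Φ : ℝ → I → ℝ, (∀ a, 0 < a → IsWeakSolution p f a (Φ a)) ∧
      ∀ t, Tendsto (fun a => Φ a t) (𝓝[>] 0) (𝓝 (φ t))

/-- The class `L^{p(·)}` of those `f ∈ L⁰` for which the stabilized solution `φ_f` exists. -/
def Lp (p : I → ℝ) : Set L0 := {f | ∃ φ : I → ℝ, IsNormSolution p f φ}

open Classical in
/-- The ODE-determined norm `φ_f(1)`; it is only used for `f` in the class `L^{p(·)}`. -/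
noncomputable def odeNorm (p : I → ℝ) (f : L0) : ℝ :=
  if h : ∃ φ : I → ℝ, IsNormSolution p f φ then h.choose 1 else 0

/-- `L^{p(·)}`, with the pointwise linear operations and the norm `f ↦ φ_f(1)`, is a
Banach space. -/
structure IsBanach (p : I → ℝ) : Prop where
  zero_mem : (0 : L0) ∈ Lp p
  add_mem : ∀ f g : L0, f ∈ Lp p → g ∈ Lp p → f + g ∈ Lp p
  smul_mem : ∀ (c : ℝ) (f : L0), f ∈ Lp p → c • f ∈ Lp p
  norm_add_le : ∀ f g : L0, f ∈ Lp p → g ∈ Lp p → odeNorm p (f + g) ≤ odeNorm p f + odeNorm p g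
  norm_smul : ∀ (c : ℝ) (f : L0), f ∈ Lp p → odeNorm p (c • f) = |c| * odeNorm p f
  eq_zero_of_norm : ∀ f : L0, f ∈ Lp p → odeNorm p f = 0 → f = 0
  complete : ∀ u : ℕ → L0, (∀ n, u n ∈ Lp p) →
    (∀ ε : ℝ, 0 < ε → ∃ N, ∀ m ≥ N, ∀ n ≥ N, odeNorm p (u m - u n) < ε) →
      ∃ f ∈ Lp p, Tendsto (fun n => odeNorm p (u n - f)) atTop (𝓝 0)

/-- `L^{p(·)}` as a linear subspace of `L⁰`. -/
def lpSubmodule (p : I → ℝ) (hB : IsBanach p) : Submodule ℝ L0 where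
  carrier := Lp p
  zero_mem' := hB.zero_mem
  add_mem' {f g} hf hg := hB.add_mem f g hf hg
  smul_mem' c f hf := hB.smul_mem c f hf

/-- The normed space `L^{p(·)}`. -/
def Space (p : I → ℝ) (hB : IsBanach p) : Type := lpSubmodule p hB

noncomputable instance (p : I → ℝ) (hB : IsBanach p) : AddCommGroup (Space p hB) :=
  inferInstanceAs (AddCommGroup (lpSubmodule p hB))

noncomputable instance (p : I → ℝ) (hB : IsBanach p) : Module ℝ (Space p hB) :=
  inferInstanceAs (Module ℝ (lpSubmodule p hB))

/-- The inclusion of `L^{p(·)}` in `L⁰`. -/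
noncomputable def toL0 (p : I → ℝ) (hB : IsBanach p) : Space p hB →ₗ[ℝ] L0 :=
  (lpSubmodule p hB).subtype

theorem toL0_mem {p : I → ℝ} {hB : IsBanach p} (f : Space p hB) : toL0 p hB f ∈ Lp p :=
  f.2

theorem toL0_injective (p : I → ℝ) (hB : IsBanach p) : Function.Injective (toL0 p hB) :=
  Subtype.val_injective

/-- The norm `f ↦ φ_f(1)` of `L^{p(·)}`. -/
noncomputable def spaceNorm (p : I → ℝ) (hB : IsBanach p) : AddGroupNorm (Space p hB) where
  toFun f := odeNorm p (toL0 p hB f)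
  map_zero' := by
    have h := hB.norm_smul 0 0 hB.zero_mem
    simpa using h
  add_le' f g := by
    rw [map_add]
    exact hB.norm_add_le _ _ (toL0_mem f) (toL0_mem g)
  neg' f := by
    have h := hB.norm_smul (-1) _ (toL0_mem f)
    rw [map_neg]
    simpa using h
  eq_zero_of_map_eq_zero' f hf := by
    apply toL0_injective p hB
    rw [map_zero]
    exact hB.eq_zero_of_norm _ (toL0_mem f) hf

noncomputable instance (p : I → ℝ) (hB : IsBanach p) : NormedAddCommGroup (Space p hB) :=
  (spaceNorm p hB).toNormedAddCommGroup

theorem norm_def {p : I → ℝ} {hB : IsBanach p} (f : Space p hB) :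
    ‖f‖ = odeNorm p (toL0 p hB f) := rfl

noncomputable instance (p : I → ℝ) (hB : IsBanach p) : NormedSpace ℝ (Space p hB) where
  norm_smul_le c f := by
    rw [norm_def, map_smul, hB.norm_smul c _ (toL0_mem f)]
    rfl

/-- The class in `L⁰` of a continuous function on `[0,1]`. -/
noncomputable def ofCont : C(I, ℝ) →ₗ[ℝ] L0 := ContinuousMap.toAEEqFunLinearMap volume

/-- The class in `L⁰` of the indicator function `1_{[0,t]}`. -/
noncomputable def indicatorClass (t : I) : L0 :=
  AEEqFun.mk ((Icc 0 t).indicator fun _ => (1 : ℝ))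
    ((aestronglyMeasurable_const).indicator measurableSet_Icc)

/-- `X`: the closure of `C[0,1]` in `L^{p(·)}`. -/
noncomputable def X (p : I → ℝ) (hB : IsBanach p) : Submodule ℝ (Space p hB) :=
  ((LinearMap.range ofCont).comap (toL0 p hB)).topologicalClosure

/-- The inclusion of `X` in `L⁰`. -/
noncomputable def classOf (p : I → ℝ) (hB : IsBanach p) : X p hB →ₗ[ℝ] L0 :=
  (toL0 p hB).comp (X p hB).subtype

/-- The special variation
`⋁_{p(·)*} μ = sup {∫ f dμ : f ∈ C[0,1], ‖f‖_{p(·)} ≤ 1} ∈ [0, ∞]` of a signed measure on `[0,1]`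
(`f = 0` is among the competitors whenever `0 ∈ L^{p(·)}`, so that the supremum is nonnegative). -/
noncomputable def specialVariation (p : I → ℝ) (μ : SignedMeasure I) : ℝ≥0∞ :=
  ⨆ (f : C(I, ℝ)) (_ : ofCont f ∈ Lp p ∧ odeNorm p (ofCont f) ≤ 1),
    ENNReal.ofReal (∫ᵛ t, f t ∂•μ)

/-- `μ` is the Lebesgue–Stieltjes measure `m_g` induced by a function `g : [0,1] → ℝ` of bounded
variation: `m_g((a, b]) = g(b+) - g(a+)` and `m_g({0}) = g(0+) - g(0)`. -/
def IsStieltjes (g : I → ℝ) (μ : SignedMeasure I) : Prop :=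
  ∃ hg : BoundedVariationOn g univ, μ = hg.vectorMeasure

end OdeNorm

/-! Everything rests on two properties of the ODE. Since `1 - p < 0`, the right-hand side decreases
in `φ` and increases in `|f|`, so solutions compare: `|f| ≤ |g|` a.e. gives `‖f‖ ≤ ‖g‖`
(`odeNorm_le_of_abs_le`). And truncating `f` to `[0,s]` freezes `φ_f` after `s`, so `‖1_{[0,s]} f‖ =
φ_f(s)`. As `φ_f` is continuous, `t ↦ 1_{[0,t]}` is right-continuous in norm, which puts the
indicators in `X` and makes `g_F` right-continuous.

The lattice property bounds the variation of `g_F` by `‖F‖ ‖1‖`. By construction `F` and `∫ ·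
dm_{g_F}` agree on step functions, hence on continuous functions by uniform approximation
(`apply_contX`). Density of `C[0,1]` then yields injectivity and the norm identity; conversely,
finite special variation says exactly that `f ↦ ∫ f dμ` is norm-bounded on `C[0,1]`, so it extends
to `X`.

For a representative valid for all `F` at once, take continuous `f_n → x` at a geometric rate. A
weak Chebyshev inequality gives a.e. convergence along a subsequence, while `∫ |h| d|m_{g_F}| ≤ ‖F‖
‖h‖` makes the same subsequence converge `|m_{g_F}|`-a.e. and in `L¹` for every `F`. Its pointwise
limit does not involve `F`. -/

namespace OdeNorm

/-! ### Carathéodory solutions: positivity, comparison, truncation. -/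

section WeakSolutions

variable {p f g φ ψ : I → ℝ} {a b : ℝ}

theorem IsWeakSolution.continuous (h : IsWeakSolution p f a φ) : Continuous φ := by
  have h1 := h.absolutelyContinuous.continuousOn
  rw [uIcc_of_le zero_le_one] at h1
  have h2 := continuousOn_iff_continuous_domRestrict.1 h1
  convert h2 using 1
  ext t
  simp

theorem IsWeakSolution.sub_eq (h : IsWeakSolution p f a φ) {s t : I} (hst : s ≤ t) :
    φ t - φ s = ∫ r in Ioc s t, field p f φ r := by
  rw [h.eq_integral t, h.eq_integral s, ← Iic_union_Ioc_eq_Iic hst,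
    setIntegral_union (Iic_disjoint_Ioc le_rfl) measurableSet_Ioc
      h.integrable.integrableOn h.integrable.integrableOn]
  ring

theorem IsWeakSolution.apply_zero (h : IsWeakSolution p f a φ) : φ 0 = a := by
  rw [h.eq_integral 0]
  have : (Iic 0 : Set I) = {0} := by
    ext x
    exact ⟨fun h => le_antisymm h unitInterval.nonneg', fun h => le_of_eq h⟩
  rw [this, Measure.restrict_zero_set (by simp)]
  simp

theorem field_nonneg (hp1 : ∀ t, 1 < p t) {t : I} (ht : 0 ≤ φ t) : 0 ≤ field p f φ t := by
  have := hp1 t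
  unfold field
  positivity

/-- Before a first time `τ` with `φ τ ≤ 0` the field is nonnegative, so `φ τ ≥ a > 0`, a
contradiction. -/
theorem IsWeakSolution.pos (hp1 : ∀ t, 1 < p t) (ha : 0 < a) (h : IsWeakSolution p f a φ) (t : I) :
    0 < φ t := by
  by_contra! ht
  have hc : IsCompact {s | φ s ≤ 0} := (isClosed_le h.continuous continuous_const).isCompact
  obtain ⟨τ, hτ, hmin⟩ := hc.exists_isLeast ⟨t, ht⟩
  have h0 : 0 ≤ ∫ r in Iic τ, field p f φ r := by
    -- The sign of the field is known only strictly before `τ`; the endpoint is null.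
    rw [← setIntegral_congr_set Iio_ae_eq_Iic]
    refine setIntegral_nonneg measurableSet_Iio fun r hr => field_nonneg hp1 ?_
    by_contra! hr'
    exact absurd (hmin hr'.le) (not_le.2 hr)
  have h1 := h.eq_integral τ
  have h2 : φ τ ≤ 0 := hτ
  linarith

theorem IsWeakSolution.monotone (hp1 : ∀ t, 1 < p t) (ha : 0 < a) (h : IsWeakSolution p f a φ) :
    Monotone φ := fun s t hst => by
  have h1 := h.sub_eq hst
  have h2 : 0 ≤ ∫ r in Ioc s t, field p f φ r :=
    setIntegral_nonneg measurableSet_Ioc fun r _ => field_nonneg hp1 (h.pos hp1 ha r).le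
  linarith

/-- Let `τ` be the last time up to `T` at which `φ ≤ ψ`. On `(τ, T]` one has `φ > ψ > 0`, and there
the negative exponent `1 - p` makes `φ` grow no faster than `ψ`. -/
theorem IsWeakSolution.le_of_abs_le (hp1 : ∀ t, 1 < p t) (hb : 0 < b) (hab : a ≤ b)
    (hf : IsWeakSolution p f a φ) (hg : IsWeakSolution p g b ψ)
    (hfg : ∀ᵐ t ∂(volume : Measure I), |f t| ≤ |g t|) (T : I) : φ T ≤ ψ T := by
  have hc : IsCompact {s | s ≤ T ∧ φ s ≤ ψ s} :=
    ((isClosed_le continuous_id continuous_const).inter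
      (isClosed_le hf.continuous hg.continuous)).isCompact
  obtain ⟨τ, ⟨hτT, hτ⟩, hmax⟩ := hc.exists_isGreatest
    ⟨0, unitInterval.nonneg', by rw [hf.apply_zero, hg.apply_zero]; exact hab⟩
  have h1 := hf.sub_eq hτT
  have h2 := hg.sub_eq hτT
  have h3 : ∫ r in Ioc τ T, field p f φ r ≤ ∫ r in Ioc τ T, field p g ψ r := by
    refine setIntegral_mono_on_ae hf.integrable.integrableOn hg.integrable.integrableOn
      measurableSet_Ioc ?_
    filter_upwards [hfg] with r hr hrI
    have hlt : ψ r ≤ φ r := by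
      by_contra! hr'
      exact absurd (hmax ⟨hrI.2, hr'.le⟩) (not_le.2 hrI.1)
    have hp := hp1 r
    have hψ := hg.pos hp1 hb r
    unfold field
    gcongr ?_ / _ * ?_
    · exact Real.rpow_nonneg (hψ.le.trans hlt) _
    · exact Real.rpow_le_rpow (abs_nonneg _) hr (by linarith)
    · exact Real.rpow_le_rpow_of_nonpos hψ hlt (by linarith)
  linarith

theorem field_congr {t : I} (h : f t = g t) : field p f φ t = field p g φ t := by
  simp [field, h]

theorem IsWeakSolution.congr (h : IsWeakSolution p f a φ) (hfg : f =ᵐ[volume] g) :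
    IsWeakSolution p g a φ := by
  have : field p f φ =ᵐ[volume] field p g φ := hfg.mono fun t ht => field_congr ht
  exact ⟨h.absolutelyContinuous, h.integrable.congr this, fun T => by
    rw [h.eq_integral T, integral_congr_ae (ae_restrict_of_ae this)]⟩

/-- The map `x ↦ min x s` is monotone and 1-Lipschitz, so it sends disjoint families of intervals to
disjoint families of no larger total length, and the same `δ` works. -/
theorem absolutelyContinuousOnInterval_comp_min {u : I → ℝ}
    (h : AbsolutelyContinuousOnInterval (IccExtend zero_le_one u) 0 1) (s : I) :
    AbsolutelyContinuousOnInterval (IccExtend zero_le_one fun t => u (min t s)) 0 1 := by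
  rw [absolutelyContinuousOnInterval_iff] at h ⊢
  intro ε hε
  obtain ⟨δ, hδ, H⟩ := h ε hε
  refine ⟨δ, hδ, fun E hE hlen => ?_⟩
  have hext : ∀ x : ℝ, IccExtend zero_le_one (fun t => u (min t s)) x =
      IccExtend zero_le_one u (min x s) := by
    intro x
    simp only [IccExtend, Function.comp_apply]
    congr 1
    have h0 := s.2.1
    have h1 := s.2.2
    ext
    have hmin : ∀ a b : I, ((min a b : I) : ℝ) = min (a : ℝ) b := fun a b =>
      Subtype.mono_coe (I : Set ℝ) |>.map_min
    rw [hmin, coe_projIcc, coe_projIcc]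
    clear H h hE hlen
    rcases le_total x s with h | h
    · rw [min_eq_left h, min_eq_left]
      simp [h0, h]
    · rw [min_eq_right h, min_eq_right (a := (1 : ℝ)) h1, max_eq_right h0, min_eq_right]
      simp [h1, h]
  simp only [hext]
  have hs0 := s.2.1
  have hs1 := s.2.2
  refine H (E.1, fun i => (min (E.2 i).1 s, min (E.2 i).2 s)) ⟨fun i hi => ?_, ?_⟩ ?_
  · have := hE.1 i hi
    simp only [uIcc_of_le (zero_le_one' ℝ), mem_Icc] at this ⊢
    grind
  · refine hE.2.mono_on fun i hi => ?_
    intro x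
    simp only [mem_uIoc]
    grind
  · refine lt_of_le_of_lt (Finset.sum_le_sum fun i _ => ?_) hlen
    simp only [Real.dist_eq]
    exact (abs_min_sub_min_le_max _ _ _ _).trans (by simp)

/-- After `s` the field vanishes because `0 ^ p = 0`, so the solution stays constant. -/
theorem IsWeakSolution.truncate (hp1 : ∀ t, 1 < p t) (h : IsWeakSolution p f a φ) (s : I) :
    IsWeakSolution p ((Iic s).indicator f) a fun t => φ (min t s) := by
  have key : field p ((Iic s).indicator f) (fun t => φ (min t s)) =
      (Iic s).indicator (field p f φ) := by
    ext t
    by_cases ht : t ≤ s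
    · simp [field, ht]
    · have hp := hp1 t
      simp [field, ht, Real.zero_rpow (show p t ≠ 0 by linarith)]
  refine ⟨absolutelyContinuousOnInterval_comp_min h.absolutelyContinuous s, ?_, fun T => ?_⟩
  · rw [key]
    exact h.integrable.indicator measurableSet_Iic
  · rw [key, setIntegral_indicator measurableSet_Iic, Iic_inter_Iic, h.eq_integral]

end WeakSolutions

/-! ### The norm: monotonicity in `|f|` and a Chebyshev inequality. -/

section NormSolutions

variable {p f g φ ψ : I → ℝ}

theorem IsNormSolution.congr (h : IsNormSolution p f φ) (hfg : f =ᵐ[volume] g) :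
    IsNormSolution p g φ := by
  obtain ⟨h0, Φ, hΦ, hlim⟩ := h
  exact ⟨h0.congr hfg, Φ, fun a ha => (hΦ a ha).congr hfg, hlim⟩

theorem IsNormSolution.le_of_abs_le (hp1 : ∀ t, 1 < p t) (hf : IsNormSolution p f φ)
    (hg : IsNormSolution p g ψ) (hfg : ∀ᵐ t ∂(volume : Measure I), |f t| ≤ |g t|) (t : I) :
    φ t ≤ ψ t := by
  obtain ⟨-, Φ, hΦ, hlim⟩ := hf
  obtain ⟨-, Ψ, hΨ, hlim'⟩ := hg
  refine le_of_tendsto_of_tendsto (hlim t) (hlim' t) ?_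
  filter_upwards [self_mem_nhdsWithin] with a ha
  exact (hΦ a ha).le_of_abs_le hp1 ha le_rfl (hΨ a ha) hfg t

theorem IsNormSolution.unique (hp1 : ∀ t, 1 < p t) (hf : IsNormSolution p f φ)
    (hg : IsNormSolution p f ψ) : φ = ψ :=
  funext fun t => le_antisymm (hf.le_of_abs_le hp1 hg (by simp) t)
    (hg.le_of_abs_le hp1 hf (by simp) t)

theorem IsNormSolution.truncate (hp1 : ∀ t, 1 < p t) (h : IsNormSolution p f φ) (s : I) :
    IsNormSolution p ((Iic s).indicator f) fun t => φ (min t s) := by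
  obtain ⟨h0, Φ, hΦ, hlim⟩ := h
  exact ⟨h0.truncate hp1 s, fun a t => Φ a (min t s), fun a ha => (hΦ a ha).truncate hp1 s,
    fun t => hlim _⟩

/-- Where the datum vanishes on `[0, s]`, the norm solution stays at `0`. -/
theorem IsNormSolution.apply_eq_zero (hp1 : ∀ t, 1 < p t) (h : IsNormSolution p f φ) {s : I}
    (hf : ∀ᵐ t ∂(volume : Measure I), t ≤ s → f t = 0) : φ s = 0 := by
  rw [h.1.eq_integral s, zero_add]
  refine setIntegral_eq_zero_of_ae_eq_zero ?_
  filter_upwards [hf] with t ht hts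
  have hp := hp1 t
  simp [field, ht hts, Real.zero_rpow (show p t ≠ 0 by linarith)]

theorem odeNorm_eq (hp1 : ∀ t, 1 < p t) {f : L0} (h : IsNormSolution p f φ) :
    odeNorm p f = φ 1 := by
  have hex : ∃ φ : I → ℝ, IsNormSolution p f φ := ⟨φ, h⟩
  rw [odeNorm, dif_pos hex, hex.choose_spec.unique hp1 h]

theorem odeNorm_le_of_abs_le (hp1 : ∀ t, 1 < p t) {f g : L0} (hf : f ∈ Lp p) (hg : g ∈ Lp p)
    (h : ∀ᵐ t ∂(volume : Measure I), |f t| ≤ |g t|) : odeNorm p f ≤ odeNorm p g := by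
  obtain ⟨φ, hφ⟩ := hf
  obtain ⟨ψ, hψ⟩ := hg
  rw [odeNorm_eq hp1 hφ, odeNorm_eq hp1 hψ]
  exact hφ.le_of_abs_le hp1 hψ h 1

/-- This is `1 + y ≤ exp y` at `y = q log r`. The lower bound is free of `q`, so it is uniform over
an unbounded exponent `p(t)`. -/
theorem log_le_rpow_div {r q : ℝ} (hr : 0 < r) (hq : 0 < q) : Real.log r ≤ r ^ q / q := by
  rw [le_div_iff₀ hq, Real.rpow_def_of_pos hr]
  linarith [Real.add_one_le_exp (Real.log r * q)]

/-- A weak Chebyshev inequality for the ODE-determined norm. -/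
theorem measureReal_mul_log_le (hp1 : ∀ t, 1 < p t) {f : L0} (hf : f ∈ Lp p) {M ε : ℝ}
    (hM : odeNorm p f < M) (hM0 : 0 < M) (hε : M ≤ ε) :
    (volume : Measure I).real {t | ε ≤ |f t|} * Real.log (ε / M) ≤ 1 := by
  obtain ⟨φ, hφ⟩ := hf
  rw [odeNorm_eq hp1 hφ] at hM
  obtain ⟨-, Φ, hΦ, hlim⟩ := hφ
  -- A positive initial value keeps the solution away from `0`, while its final value is still below
  -- `M`.
  obtain ⟨a, haM, ha⟩ := (((hlim 1).eventually_lt_const hM).and self_mem_nhdsWithin).exists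
  have ha : 0 < a := ha
  have hsol := hΦ a ha
  have hε0 : 0 < ε := hM0.trans_le hε
  set S : Set I := {t | ε ≤ |f t|} with hS
  have hSm : NullMeasurableSet S volume :=
    nullMeasurableSet_le aemeasurable_const f.aestronglyMeasurable.aemeasurable.abs
  have hlog : 0 ≤ Real.log (ε / M) := Real.log_nonneg (by rwa [one_le_div hM0])
  -- On `S` the solution is at most `M`, so the field is at least `M (ε/M)^p / p ≥ M log (ε/M)`; its
  -- total integral is less than `M`.
  have hint : ∫ t in S, M * Real.log (ε / M) ≤ ∫ t in S, field p f (Φ a) t := by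
    refine setIntegral_mono_on₀ (integrableOn_const (by finiteness))
      hsol.integrable.integrableOn hSm fun t ht => ?_
    have hp := hp1 t
    have h1 : Φ a t ≤ M := (hsol.monotone hp1 ha unitInterval.le_one').trans haM.le
    have h2 := hsol.pos hp1 ha t
    calc M * Real.log (ε / M) ≤ M * ((ε / M) ^ p t / p t) := by
          gcongr
          exact log_le_rpow_div (by positivity) (by linarith)
      _ = ε ^ p t / p t * M ^ (1 - p t) := by
          rw [Real.div_rpow hε0.le hM0.le, Real.rpow_sub hM0, Real.rpow_one]
          field_simp
      _ ≤ |f t| ^ p t / p t * Φ a t ^ (1 - p t) := by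
          gcongr ?_ / _ * ?_
          · exact Real.rpow_le_rpow hε0.le ht (by linarith)
          · exact Real.rpow_le_rpow_of_nonpos h2 h1 (by linarith)
  have hle : ∫ t in S, field p f (Φ a) t ≤ ∫ t, field p f (Φ a) t :=
    setIntegral_le_integral hsol.integrable
      (.of_forall fun t => field_nonneg hp1 (hsol.pos hp1 ha t).le)
  have h1 := hsol.eq_integral 1
  have : (Iic 1 : Set I) = univ := eq_univ_of_forall fun t => unitInterval.le_one'
  rw [this, setIntegral_univ] at h1
  simp only [setIntegral_const, smul_eq_mul] at hint
  have : M * (volume.real S * Real.log (ε / M)) ≤ M * 1 := by linarith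
  exact le_of_mul_le_mul_left this hM0

end NormSolutions

end OdeNorm

/-! ### Signed measures tested against continuous functions. -/

namespace MeasureTheory.SignedMeasure

section Jordan

variable {α : Type*} [MeasurableSpace α] (μ : SignedMeasure α)

instance isFiniteMeasure_variation : IsFiniteMeasure μ.variation := by
  rw [← totalVariation_eq_variation]
  unfold totalVariation
  infer_instance

theorem integral_eq_integral_posPart_sub_integral_negPart {f : α → ℝ}
    (hf : Integrable f μ.variation) :
    ∫ᵛ x, f x ∂•μ = ∫ x, f x ∂μ.toJordanDecomposition.posPart -
      ∫ x, f x ∂μ.toJordanDecomposition.negPart := by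
  have hB : ContinuousLinearMap.lsmul ℝ ℝ = (ContinuousLinearMap.lsmul ℝ ℝ (E := ℝ)).flip := by
    ext
    simp
  rw [← totalVariation_eq_variation, totalVariation] at hf
  have h1 : Integrable f μ.toJordanDecomposition.posPart := hf.left_of_add_measure
  have h2 : Integrable f μ.toJordanDecomposition.negPart := hf.right_of_add_measure
  conv_lhs => rw [← toSignedMeasure_toJordanDecomposition μ]
  rw [JordanDecomposition.toSignedMeasure, VectorMeasure.integral_sub_vectorMeasure, hB,
    VectorMeasure.integral_toSignedMeasure, VectorMeasure.integral_toSignedMeasure]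
  · simpa [VectorMeasure.Integrable] using h1
  · simpa [VectorMeasure.Integrable] using h2

/-- A signed measure has a measurable sign with respect to its variation. -/
theorem exists_sign : ∃ s : α → ℝ, Measurable s ∧ (∀ x, |s x| = 1) ∧
    ∀ f : α → ℝ, Integrable f μ.variation →
      ∫ᵛ x, s x * f x ∂•μ = ∫ x, f x ∂μ.variation := by
  classical
  obtain ⟨S, hS, -, -, hpos, hneg⟩ := μ.toJordanDecomposition.exists_compl_positive_negative
  -- The positive part does not charge `S` and the negative part does not charge its complement.
  set s : α → ℝ := S.piecewise (fun _ => -1) fun _ => 1 with hs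
  have hsm : Measurable s := Measurable.piecewise hS measurable_const measurable_const
  have hs1 : ∀ x, |s x| = 1 := fun x => by by_cases hx : x ∈ S <;> simp [hs, hx]
  refine ⟨s, hsm, hs1, fun f hf => ?_⟩
  have hsf : Integrable (fun x => s x * f x) μ.variation := by
    refine hf.mono (hsm.aestronglyMeasurable.mul hf.1) (.of_forall fun x => ?_)
    simp [hs1]
  rw [μ.integral_eq_integral_posPart_sub_integral_negPart hsf]
  rw [← totalVariation_eq_variation, totalVariation] at hf ⊢
  rw [integral_add_measure hf.left_of_add_measure hf.right_of_add_measure, sub_eq_add_neg,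
    ← integral_neg]
  congr 1
  · refine integral_congr_ae ?_
    filter_upwards [measure_eq_zero_iff_ae_notMem.1 hpos] with x hx
    simp [hs, hx]
  · refine integral_congr_ae ?_
    filter_upwards [measure_eq_zero_iff_ae_notMem.1 hneg] with x hx
    simp [hs, not_not.1 hx]

end Jordan

/-- Projecting onto an interval that contains `b` never increases the distance to `b`. -/
theorem abs_sub_clamp_le {a b r : ℝ} (hb : |b| ≤ r) :
    |b - max (-r) (min a r)| ≤ |b - a| := by
  rw [abs_le] at hb
  grind

section Continuous

variable {α : Type*} [MetricSpace α] [CompactSpace α] [MeasurableSpace α] [BorelSpace α]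
  {μ ν : SignedMeasure α}

theorem integrable_continuousMap (f : C(α, ℝ)) : μ.Integrable f :=
  f.continuous.integrable_of_hasCompactSupport (HasCompactSupport.of_compactSpace f)

/-- The integral of `|h|` against the variation is the supremum of the integrals of the continuous
functions dominated by `|h|`. -/
theorem integral_abs_variation_le {h : C(α, ℝ)} {C : ℝ}
    (H : ∀ k : C(α, ℝ), (∀ x, |k x| ≤ |h x|) → ∫ᵛ x, k x ∂•μ ≤ C) :
    ∫ x, |h x| ∂μ.variation ≤ C := by
  obtain ⟨s, hsm, hs1, hs⟩ := μ.exists_sign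
  have hh : Integrable (fun x => |h x|) μ.variation := (integrable_continuousMap (μ := μ) h).abs
  rw [← hs _ hh]
  have hw : Integrable (fun x => s x * |h x|) μ.variation := by
    refine hh.mono (hsm.aestronglyMeasurable.mul hh.1) (.of_forall fun x => ?_)
    simp [hs1]
  refine le_of_forall_pos_le_add fun ε hε => ?_
  obtain ⟨g, hg, -⟩ := hw.exists_boundedContinuous_integral_sub_le hε
  -- Clamping the `L¹`-approximant `g` of `s |h|` to `[-|h|, |h|]` makes it an admissible competitor
  -- without enlarging the error.
  let k : C(α, ℝ) := ⟨fun x => max (-|h x|) (min (g x) |h x|), by fun_prop⟩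
  have hk : ∀ x, |k x| ≤ |h x| := fun x => abs_le.2
    ⟨le_max_left _ _, max_le (by linarith [abs_nonneg (h x)]) (min_le_right _ _)⟩
  have hkw : ∀ x, ‖s x * |h x| - k x‖ ≤ ‖s x * |h x| - g x‖ := fun x => by
    have h1 : |s x * (|h x|)| ≤ |h x| := by simp [abs_mul, hs1]
    exact abs_sub_clamp_le h1
  have hkint := integrable_continuousMap (μ := μ) k
  have hgint : Integrable (fun x => g x) μ.variation :=
    integrable_continuousMap (μ := μ) g.toContinuousMap
  have h1 : ‖∫ᵛ x, (s x * |h x| - k x) ∂•μ‖ ≤ ε := by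
    refine (VectorMeasure.norm_integral_le_integral_norm).trans ?_
    have hB : ‖ContinuousLinearMap.lsmul ℝ ℝ (E := ℝ)‖ ≤ 1 :=
      ContinuousLinearMap.opNorm_lsmul_le
    have h0 : 0 ≤ ∫ x, ‖s x * |h x| - k x‖ ∂μ.variation :=
      integral_nonneg fun _ => norm_nonneg _
    calc _ ≤ 1 * ∫ x, ‖s x * |h x| - k x‖ ∂μ.variation := by gcongr
      _ ≤ ∫ x, ‖s x * |h x| - g x‖ ∂μ.variation := by
          rw [one_mul]
          exact integral_mono (hw.sub hkint).norm (hw.sub hgint).norm hkw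
      _ ≤ ε := hg
  rw [VectorMeasure.integral_fun_sub hw hkint, Real.norm_eq_abs] at h1
  linarith [H k hk, (abs_le.1 h1).2]

/-- The case `h = 1` of the preceding bound shows that the total variation has mass zero. -/
theorem eq_zero_of_forall_integral_eq_zero (H : ∀ f : C(α, ℝ), ∫ᵛ x, f x ∂•μ = 0) : μ = 0 := by
  have h1 := integral_abs_variation_le (μ := μ) (h := 1) (C := 0) fun k _ => (H k).le
  have h2 : μ.variation.real univ ≤ 0 := by simpa using h1
  have h3 : μ.variation univ = 0 := by
    rw [← measureReal_eq_zero_iff]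
    exact le_antisymm h2 measureReal_nonneg
  exact VectorMeasure.variation_eq_zero.1 (Measure.measure_univ_eq_zero.1 h3)

theorem ext_of_forall_integral_eq (H : ∀ f : C(α, ℝ), ∫ᵛ x, f x ∂•μ = ∫ᵛ x, f x ∂•ν) : μ = ν := by
  rw [← sub_eq_zero]
  refine eq_zero_of_forall_integral_eq_zero fun f => ?_
  rw [VectorMeasure.integral_sub_vectorMeasure (integrable_continuousMap f)
    (integrable_continuousMap f), H f, sub_self]

end Continuous

end MeasureTheory.SignedMeasure

/-! ### Step functions built from the indicators of `[0,t]`. -/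

namespace OdeNorm

/-- The indicator function of `[0, t]`. -/
noncomputable def ind (t : I) : I → ℝ := (Icc 0 t).indicator fun _ => 1

theorem ind_apply (t x : I) : ind t x = if x ≤ t then 1 else 0 := by
  simp [ind, indicator]

theorem ind_mono {s t : I} (hst : s ≤ t) (x : I) : ind s x ≤ ind t x := by
  rw [ind_apply, ind_apply]
  grind

theorem ind_nonneg (t x : I) : 0 ≤ ind t x := by
  rw [ind_apply]
  grind

theorem ind_le_one (t x : I) : ind t x ≤ 1 := by
  rw [ind_apply]
  grind

/-- The increments are nonnegative and telescope. Only the coefficient of the interval `(u i, u (i +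
1)]` containing `x` has to be small, which is what uniform continuity provides. -/
theorem abs_sum_mul_ind_sub_le {n : ℕ} {u : ℕ → I} (hu : Monotone u) {c : ℕ → ℝ} {ε : ℝ} (x : I)
    (hc : ∀ i, ind (u (i + 1)) x ≠ ind (u i) x → |c i| ≤ ε) :
    |∑ i ∈ Finset.range n, c i * (ind (u (i + 1)) x - ind (u i) x)| ≤
      ε * (ind (u n) x - ind (u 0) x) := by
  rw [← Finset.sum_range_sub (fun i => ind (u i) x), Finset.mul_sum]
  refine (Finset.abs_sum_le_sum_abs _ _).trans (Finset.sum_le_sum fun i _ => ?_)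
  have h0 : 0 ≤ ind (u (i + 1)) x - ind (u i) x := sub_nonneg.2 (ind_mono (hu i.le_succ) x)
  rw [abs_mul, abs_of_nonneg h0]
  by_cases h : ind (u (i + 1)) x = ind (u i) x
  · simp [h]
  · exact mul_le_mul_of_nonneg_right (hc i h) h0

/-- The step function takes the left-endpoint value of `f` on each interval of a uniform mesh finer
than `δ`. The half-open intervals miss the point `0`, whence the term `f 0 * ind 0 x`. -/
theorem exists_abs_sub_step_le (f : C(I, ℝ)) {ε : ℝ} (hε : 0 < ε) :
    ∃ (n : ℕ) (c : ℕ → ℝ) (u : ℕ → I), ∀ x,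
      |f x - (f 0 * ind 0 x + ∑ i ∈ Finset.range n, c i * (ind (u (i + 1)) x - ind (u i) x))| ≤
        ε := by
  obtain ⟨δ, hδ, H⟩ := Metric.uniformContinuous_iff.1
    (CompactSpace.uniformContinuous_of_continuous f.continuous) ε hε
  obtain ⟨n, hn⟩ := exists_nat_one_div_lt hδ
  set N : ℝ := n + 1 with hN
  have hN0 : 0 < N := by positivity
  let u : ℕ → I := fun i => projIcc 0 1 zero_le_one (i / N)
  have hu : Monotone u := fun i j hij => monotone_projIcc _ (by gcongr)
  have hu0 : u 0 = 0 := by simp [u]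
  have hu1 : u (n + 1) = 1 := projIcc_of_right_le _ (by simp [← hN, div_self hN0.ne'])
  refine ⟨n + 1, fun i => f (u i), u, fun x => ?_⟩
  have key : f x - (f 0 * ind 0 x +
      ∑ i ∈ Finset.range (n + 1), f (u i) * (ind (u (i + 1)) x - ind (u i) x)) =
      ∑ i ∈ Finset.range (n + 1), (f x - f (u i)) * (ind (u (i + 1)) x - ind (u i) x) := by
    simp only [sub_mul, Finset.sum_sub_distrib]
    rw [← Finset.mul_sum, Finset.sum_range_sub (fun i => ind (u i) x), hu0, hu1]
    have h1 : ind 1 x = 1 := by simp [ind_apply, unitInterval.le_one']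
    have h2 : f 0 * ind 0 x = f x * ind 0 x := by
      by_cases hx : x ≤ 0
      · rw [le_antisymm hx unitInterval.nonneg']
      · simp [ind_apply, hx]
    rw [h1, h2]
    ring
  rw [key]
  refine (abs_sum_mul_ind_sub_le hu (ε := ε) x fun i hi => ?_).trans ?_
  · have h1 : u i < x ∧ x ≤ u (i + 1) := by
      rw [ind_apply, ind_apply] at hi
      have := hu i.le_succ
      grind
    refine (H ?_).le
    have h2 : (u i : ℝ) < x := h1.1
    have h3 : (x : ℝ) ≤ u (i + 1) := h1.2
    have h4 : (i : ℝ) / N ≤ 1 := by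
      by_contra! h
      have : u i = 1 := projIcc_of_right_le _ h.le
      exact absurd h1.1 (not_lt.2 (this ▸ unitInterval.le_one'))
    have h5 : (u i : ℝ) = i / N := by
      simp only [u, coe_projIcc]
      rw [min_eq_right h4, max_eq_right (by positivity)]
    have h6 : (u (i + 1) : ℝ) ≤ (i + 1) / N := by
      simp only [u, coe_projIcc]
      refine max_le (by positivity) ((min_le_right _ _).trans ?_)
      push_cast
      rfl
    rw [Subtype.dist_eq, Real.dist_eq, abs_of_pos (by linarith)]
    have : ((i : ℝ) + 1) / N = i / N + 1 / N := by ring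
    linarith
  · have := ind_nonneg (u 0) x
    have := ind_le_one (u (n + 1)) x
    nlinarith

/-! ### Pointwise representatives and convergence in measure. -/

section Represents

variable {p : I → ℝ} {hB : IsBanach p} {x y : Space p hB} {f g : I → ℝ}

/-- `f` is a representative of the class `x`. -/
def Represents (x : Space p hB) (f : I → ℝ) : Prop := toL0 p hB x =ᵐ[volume] f

theorem Represents.add (hx : Represents x f) (hy : Represents y g) :
    Represents (x + y) fun t => f t + g t := by
  unfold Represents at *
  rw [map_add]
  filter_upwards [AEEqFun.coeFn_add (toL0 p hB x) (toL0 p hB y), hx, hy] with t h1 h2 h3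
  rw [h1, Pi.add_apply, h2, h3]

theorem Represents.sub (hx : Represents x f) (hy : Represents y g) :
    Represents (x - y) fun t => f t - g t := by
  unfold Represents at *
  rw [map_sub]
  filter_upwards [AEEqFun.coeFn_sub (toL0 p hB x) (toL0 p hB y), hx, hy] with t h1 h2 h3
  rw [h1, Pi.sub_apply, h2, h3]

theorem Represents.smul (c : ℝ) (hx : Represents x f) : Represents (c • x) fun t => c * f t := by
  unfold Represents at *
  rw [map_smul]
  filter_upwards [AEEqFun.coeFn_smul c (toL0 p hB x), hx] with t h1 h2
  rw [h1, Pi.smul_apply, h2, smul_eq_mul]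

theorem represents_zero : Represents (0 : Space p hB) 0 := by
  unfold Represents
  rw [map_zero]
  exact AEEqFun.coeFn_zero

theorem Represents.sum {ι : Type*} {s : Finset ι} {x : ι → Space p hB} {f : ι → I → ℝ}
    (h : ∀ i, Represents (x i) (f i)) : Represents (∑ i ∈ s, x i) fun t => ∑ i ∈ s, f i t := by
  classical
  induction s using Finset.induction_on with
  | empty =>
    simp only [Finset.sum_empty]
    exact represents_zero
  | insert i s hi ih =>
    simp only [Finset.sum_insert hi]
    exact (h i).add ih

theorem Represents.norm_le (hp1 : ∀ t, 1 < p t) (hx : Represents x f) (hy : Represents y g)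
    (h : ∀ᵐ t ∂(volume : Measure I), |f t| ≤ |g t|) : ‖x‖ ≤ ‖y‖ := by
  refine odeNorm_le_of_abs_le hp1 (toL0_mem x) (toL0_mem y) ?_
  filter_upwards [hx, hy, h] with t h1 h2 h3
  rwa [h1, h2]

theorem Represents.norm_eq (hp1 : ∀ t, 1 < p t) {φ : I → ℝ} (hx : Represents x f)
    (hφ : IsNormSolution p f φ) : ‖x‖ = φ 1 :=
  odeNorm_eq hp1 (hφ.congr hx.symm)

/-- Convergence in the ODE-determined norm implies convergence in measure. -/
theorem tendstoInMeasure_of_tendsto (hp1 : ∀ t, 1 < p t) {x : ℕ → Space p hB} {y : Space p hB}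
    (h : Tendsto x atTop (𝓝 y)) :
    TendstoInMeasure volume (fun n => (toL0 p hB (x n) : I → ℝ)) atTop (toL0 p hB y) := by
  rw [tendstoInMeasure_iff_measureReal_norm]
  intro ε hε
  rw [Metric.tendsto_atTop]
  intro η hη
  -- The second entry forces `log (ε / M) ≥ 2 / η`, so the exceptional set has measure at most `η /
  -- 2`; the first meets the condition `M ≤ ε` of the Chebyshev bound.
  set M : ℝ := min ε (ε * Real.exp (-(2 / η))) with hM
  have hM0 : 0 < M := by positivity
  obtain ⟨N, hN⟩ := Metric.tendsto_atTop.1 h M hM0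
  refine ⟨N, fun n hn => ?_⟩
  have h1 : odeNorm p (toL0 p hB (x n - y)) < M := by
    have := hN n hn
    rwa [dist_eq_norm] at this
  have h2 := measureReal_mul_log_le hp1 (toL0_mem (x n - y)) h1 hM0 (min_le_left _ _)
  have h3 : 2 / η ≤ Real.log (ε / M) := by
    rw [Real.le_log_iff_exp_le (by positivity), le_div_iff₀ hM0]
    calc Real.exp (2 / η) * M ≤ Real.exp (2 / η) * (ε * Real.exp (-(2 / η))) := by
          gcongr
          exact min_le_right _ _
      _ = ε := by
          rw [Real.exp_neg]
          field_simp
  have h4 : (volume : Measure I).real {t | ε ≤ |toL0 p hB (x n - y) t|} =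
      (volume : Measure I).real {t | ε ≤ ‖toL0 p hB (x n) t - toL0 p hB y t‖} := by
    refine measureReal_congr ?_
    have h5 : Represents (x n) (toL0 p hB (x n)) := ae_eq_rfl
    have h6 : Represents y (toL0 p hB y) := ae_eq_rfl
    filter_upwards [h5.sub h6] with t ht
    show (ε ≤ |toL0 p hB (x n - y) t|) = (ε ≤ ‖toL0 p hB (x n) t - toL0 p hB y t‖)
    rw [ht, Real.norm_eq_abs]
  rw [h4] at h2
  set m := (volume : Measure I).real {t | ε ≤ ‖toL0 p hB (x n) t - toL0 p hB y t‖} with hm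
  have hm0 : 0 ≤ m := measureReal_nonneg
  rw [Real.dist_eq, sub_zero, abs_of_nonneg hm0]
  have h7 : m * (2 / η) ≤ 1 := (mul_le_mul_of_nonneg_left h3 hm0).trans h2
  rw [mul_div_assoc', div_le_one hη] at h7
  linarith

end Represents

/-! ### Continuous functions and indicators as elements of `X`. -/

section Elements

variable {p : I → ℝ} (hp1 : ∀ t, 1 < p t) (hB : IsBanach p)
  (hC : ∀ f : C(I, ℝ), ofCont f ∈ Lp p)

theorem coeFn_ofCont (f : C(I, ℝ)) : ofCont f =ᵐ[volume] f :=
  ContinuousMap.coeFn_toAEEqFun volume f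

theorem coeFn_indicatorClass (t : I) : indicatorClass t =ᵐ[volume] ind t :=
  AEEqFun.coeFn_mk _ _

theorem indicatorClass_mem {p : I → ℝ} (hp1 : ∀ t, 1 < p t)
    (hC : ∀ f : C(I, ℝ), ofCont f ∈ Lp p) (t : I) : indicatorClass t ∈ Lp p := by
  obtain ⟨φ, hφ⟩ := hC 1
  refine ⟨_, ((hφ.congr (coeFn_ofCont 1)).truncate hp1 t).congr ?_⟩
  refine EventuallyEq.trans (.of_eq ?_) (coeFn_indicatorClass t).symm
  ext x
  simp [ind_apply, indicator]

/-- The class of a continuous function as an element of `L^{p(·)}`. -/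
noncomputable def contSpace : C(I, ℝ) →ₗ[ℝ] Space p hB :=
  LinearMap.codRestrict (lpSubmodule p hB) ofCont hC

/-- The indicator function of `[0, t]` as an element of `L^{p(·)}`. -/
noncomputable def indSpace (t : I) : Space p hB :=
  (⟨indicatorClass t, indicatorClass_mem hp1 hC t⟩ : lpSubmodule p hB)

theorem represents_contSpace (f : C(I, ℝ)) : Represents (contSpace hB hC f) f := coeFn_ofCont f

theorem represents_indSpace (t : I) : Represents (indSpace hp1 hB hC t) (ind t) :=
  coeFn_indicatorClass t

/-- Let `ψ` be the norm solution for `1 - 1_{[0,t]}`. For `s ≥ t`, truncating this datum at `s`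
gives `1_{[0,s]} - 1_{[0,t]}`, whose norm is therefore `ψ s`; and `ψ` is continuous with `ψ t = 0`.
-/
theorem tendsto_indSpace (t : I) :
    Tendsto (indSpace hp1 hB hC) (𝓝[≥] t) (𝓝 (indSpace hp1 hB hC t)) := by
  obtain ⟨ψ, hψ⟩ := toL0_mem (contSpace hB hC 1 - indSpace hp1 hB hC t)
  have hψ := hψ.congr ((represents_contSpace hB hC 1).sub (represents_indSpace hp1 hB hC t))
  have h0 : ψ t = 0 := hψ.apply_eq_zero hp1 (.of_forall fun s hs => by simp [ind_apply, hs])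
  rw [tendsto_iff_norm_sub_tendsto_zero, ← h0]
  refine (hψ.1.continuous.continuousWithinAt (s := Ici t) (x := t)).tendsto.congr' ?_
  filter_upwards [self_mem_nhdsWithin] with s hs
  have hs : t ≤ s := hs
  rw [((represents_indSpace hp1 hB hC s).sub (represents_indSpace hp1 hB hC t)).norm_eq hp1
    (φ := fun r => ψ (min r s))]
  · rw [min_eq_right unitInterval.le_one']
  · convert hψ.truncate hp1 s using 1
    ext r
    by_cases hr : r ≤ s
    · simp [ind_apply, hr]
    · simpa [ind_apply, hr] using hs.trans_lt (not_le.1 hr)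

theorem contSpace_mem_X (f : C(I, ℝ)) : contSpace hB hC f ∈ X p hB :=
  Submodule.le_topologicalClosure _ ⟨f, rfl⟩

/-- For `t < 1`, a Urysohn function `k` equal to `1` on `[0,t]` and `0` on `[s,1]` satisfies `|k -
1_{[0,t]}| ≤ 1_{[0,s]} - 1_{[0,t]}`, which is small in norm for `s` close to `t`. For `t = 1` the
indicator is the constant `1`. -/
theorem indSpace_mem_X (t : I) : indSpace hp1 hB hC t ∈ X p hB := by
  rcases eq_or_ne t 1 with rfl | ht
  · convert contSpace_mem_X hB hC 1 using 1
    refine toL0_injective p hB (AEEqFun.ext ?_)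
    filter_upwards [represents_contSpace hB hC 1, represents_indSpace hp1 hB hC 1] with x h1 h2
    rw [h1, h2, ind_apply, if_pos unitInterval.le_one']
    rfl
  have ht : t < 1 := lt_of_le_of_ne unitInterval.le_one' ht
  have : (𝓝[>] t).NeBot := nhdsGT_neBot_of_exists_gt ⟨1, ht⟩
  refine Metric.mem_closure_iff.2 fun ε hε => ?_
  obtain ⟨s, hs, hts⟩ := (((Metric.tendsto_nhds.1 (tendsto_indSpace hp1 hB hC t) ε hε).filter_mono
    (nhdsWithin_mono t Ioi_subset_Ici_self)).and self_mem_nhdsWithin).exists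
  have hts : t < s := hts
  obtain ⟨k, hk0, hk1, hk⟩ := exists_continuous_zero_one_of_isClosed (isClosed_Ici (a := s))
    (isClosed_Iic (a := t)) (disjoint_left.2 fun x h1 h2 => absurd (h1.trans h2) (not_le.2 hts))
  refine ⟨contSpace hB hC k, ⟨k, rfl⟩, lt_of_le_of_lt ?_ hs⟩
  rw [dist_comm, dist_eq_norm, dist_eq_norm]
  refine ((represents_contSpace hB hC k).sub (represents_indSpace hp1 hB hC t)).norm_le hp1
    ((represents_indSpace hp1 hB hC s).sub (represents_indSpace hp1 hB hC t)) (.of_forall ?_)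
  intro x
  have hkx := hk x
  rw [ind_apply, ind_apply]
  by_cases h1 : x ≤ t
  · simp [h1, h1.trans hts.le, hk1 h1]
  · by_cases h2 : x ≤ s
    · simpa [h1, h2, abs_of_nonneg hkx.1] using hkx.2
    · simp [h1, h2, hk0 (not_le.1 h2).le]

/-- The class of a continuous function as an element of `X`. -/
noncomputable def contX : C(I, ℝ) →ₗ[ℝ] X p hB :=
  (contSpace hB hC).codRestrict (X p hB) (contSpace_mem_X hB hC)

/-- The indicator function of `[0, t]` as an element of `X`. -/
noncomputable def indX (t : I) : X p hB := ⟨indSpace hp1 hB hC t, indSpace_mem_X hp1 hB hC t⟩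

theorem represents_contX (f : C(I, ℝ)) : Represents (contX hB hC f : Space p hB) f :=
  represents_contSpace hB hC f

theorem represents_indX (t : I) : Represents (indX hp1 hB hC t : Space p hB) (ind t) :=
  represents_indSpace hp1 hB hC t

theorem denseRange_contX : DenseRange (contX hB hC) := by
  refine Metric.denseRange_iff.2 fun x r hr => ?_
  obtain ⟨z, ⟨f, hf⟩, hz⟩ := Metric.mem_closure_iff.1 x.2 r hr
  refine ⟨f, ?_⟩
  have : contSpace hB hC f = z := toL0_injective p hB hf
  rw [Subtype.dist_eq]
  rwa [← this] at hz

theorem classOf_injective : Function.Injective (classOf p hB) :=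
  (toL0_injective p hB).comp Subtype.val_injective

theorem norm_contX_le (hp1 : ∀ t, 1 < p t) {f g : C(I, ℝ)} (h : ∀ t, |f t| ≤ |g t|) :
    ‖contX hB hC f‖ ≤ ‖contX hB hC g‖ :=
  (represents_contX hB hC f).norm_le hp1 (represents_contX hB hC g) (.of_forall h)

theorem indX_zero : indX hp1 hB hC 0 = 0 := by
  rw [← norm_le_zero_iff, ← norm_zero (E := X p hB)]
  refine (represents_indX hp1 hB hC 0).norm_le hp1 represents_zero ?_
  filter_upwards [Measure.ae_ne volume (0 : I)] with x hx
  have : ¬ x ≤ 0 := fun h => hx (le_antisymm h unitInterval.nonneg')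
  simp [ind_apply, this]

theorem tendsto_indX (t : I) :
    Tendsto (indX hp1 hB hC) (𝓝[≥] t) (𝓝 (indX hp1 hB hC t)) :=
  tendsto_subtype_rng.2 (tendsto_indSpace hp1 hB hC t)

end Elements

variable {p : I → ℝ} (hp1 : ∀ t, 1 < p t) (hB : IsBanach p)
  (hC : ∀ f : C(I, ℝ), ofCont f ∈ Lp p)

/-! ### The Stieltjes measure of a functional. -/

section Functional

variable (F : StrongDual ℝ (X p hB))

/-- With `c i` the sign of the `i`-th increment of `g_F`, a variation sum is the value of `F` at a
step function bounded by `1`, hence at most `‖F‖ ‖1‖`. -/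
theorem boundedVariationOn_apply_indX :
    BoundedVariationOn (fun t => F (indX hp1 hB hC t)) univ := by
  refine ne_top_of_le_ne_top (ENNReal.ofReal_ne_top (r := ‖F‖ * ‖contX hB hC 1‖)) ?_
  refine iSup_le fun ⟨n, u, hu, _⟩ => ?_
  dsimp only
  set d : ℕ → X p hB := fun i => indX hp1 hB hC (u (i + 1)) - indX hp1 hB hC (u i) with hd
  set c : ℕ → ℝ := fun i => SignType.sign (F (d i)) with hc
  have h1 : ∀ i, edist (F (indX hp1 hB hC (u (i + 1)))) (F (indX hp1 hB hC (u i))) =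
      ENNReal.ofReal (c i * F (d i)) := fun i => by
    rw [edist_dist, Real.dist_eq, hd, ← map_sub, sign_mul_self]
  simp only [h1]
  rw [← ENNReal.ofReal_sum_of_nonneg fun i _ => by rw [sign_mul_self]; exact abs_nonneg _]
  refine ENNReal.ofReal_le_ofReal ?_
  have h2 : ∑ i ∈ Finset.range n, c i * F (d i) = F (∑ i ∈ Finset.range n, c i • d i) := by
    simp
  rw [h2]
  refine (le_abs_self _).trans ((F.le_opNorm _).trans ?_)
  gcongr
  have h3 : Represents ((∑ i ∈ Finset.range n, c i • d i : X p hB) : Space p hB) fun x =>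
      ∑ i ∈ Finset.range n, c i * (ind (u (i + 1)) x - ind (u i) x) := by
    rw [Submodule.coe_sum]
    exact Represents.sum fun i =>
      (((represents_indX hp1 hB hC _).sub (represents_indX hp1 hB hC _)).smul (c i))
  refine h3.norm_le hp1 (represents_contX hB hC 1) (.of_forall fun x => ?_)
  refine (abs_sum_mul_ind_sub_le hu (ε := 1) x fun i _ => ?_).trans ?_
  · simp only [hc]
    rcases SignType.sign (F (d i)) with _ | _ | _ <;> simp
  · have := ind_nonneg (u 0) x
    have := ind_le_one (u n) x
    simp only [ContinuousMap.one_apply, abs_one]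
    linarith

/-- The Lebesgue–Stieltjes measure of `t ↦ F (1_{[0,t]})`. -/
noncomputable def stieltjesMeasure : SignedMeasure I :=
  (boundedVariationOn_apply_indX hp1 hB hC F).vectorMeasure

/-- Right-continuity of `g_F` identifies the right limit at `t`; at the left end the contribution is
`g_F 0 = 0`, because `{0}` is a null set. -/
theorem stieltjesMeasure_Icc (t : I) :
    stieltjesMeasure hp1 hB hC F (Icc 0 t) = F (indX hp1 hB hC t) := by
  rw [stieltjesMeasure, BoundedVariationOn.vectorMeasure_Icc _ unitInterval.nonneg',
    leftLim_eq_of_isBot fun x => unitInterval.nonneg', indX_zero, map_zero, sub_zero]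
  refine ContinuousWithinAt.rightLim_eq ?_
  exact (F.continuous.tendsto _).comp (tendsto_indX hp1 hB hC t)

theorem integrable_ind (μ : SignedMeasure I) (t : I) : μ.Integrable (ind t) :=
  (integrable_const (1 : ℝ)).indicator measurableSet_Icc

theorem integral_ind (μ : SignedMeasure I) (t : I) : ∫ᵛ x, ind t x ∂•μ = μ (Icc 0 t) := by
  refine (VectorMeasure.integral_indicator_const (1 : ℝ) measurableSet_Icc).trans ?_
  simp

/-- Both sides agree on step functions. A uniform error `ε` changes the left side by at most `ε ‖F‖
‖1‖`, by the lattice property, and the right side by at most `ε` times the total variation. -/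
theorem apply_contX (f : C(I, ℝ)) :
    F (contX hB hC f) = ∫ᵛ x, f x ∂•stieltjesMeasure hp1 hB hC F := by
  set μ := stieltjesMeasure hp1 hB hC F with hμ
  set K : ℝ := ‖F‖ * ‖contX hB hC 1‖ + μ.variation.real univ with hK
  suffices H : ∀ ε : ℝ, 0 < ε → |F (contX hB hC f) - ∫ᵛ x, f x ∂•μ| ≤ ε * K by
    have hlim : Tendsto (fun ε : ℝ => ε * K) (𝓝[>] 0) (𝓝 (0 * K)) :=
      (continuous_id.mul continuous_const).continuousWithinAt
    rw [zero_mul] at hlim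
    have := ge_of_tendsto hlim (eventually_mem_nhdsWithin.mono H)
    exact sub_eq_zero.1 (abs_nonpos_iff.1 this)
  intro ε hε
  obtain ⟨n, c, u, H⟩ := exists_abs_sub_step_le f hε
  set s : I → ℝ := fun x =>
    f 0 * ind 0 x + ∑ i ∈ Finset.range n, c i * (ind (u (i + 1)) x - ind (u i) x) with hs
  set z : X p hB := f 0 • indX hp1 hB hC 0 +
    ∑ i ∈ Finset.range n, c i • (indX hp1 hB hC (u (i + 1)) - indX hp1 hB hC (u i)) with hz
  have hzs : Represents (z : Space p hB) s := by
    rw [hz, Submodule.coe_add, Submodule.coe_sum]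
    exact ((represents_indX hp1 hB hC 0).smul _).add (Represents.sum fun i =>
      (((represents_indX hp1 hB hC _).sub (represents_indX hp1 hB hC _)).smul (c i)))
  have hi : ∀ (c : ℝ) (a b : I), μ.Integrable fun x => c * (ind a x - ind b x) := fun c a b =>
    ((integrable_ind μ a).sub (integrable_ind μ b)).const_mul c
  have hi0 : μ.Integrable fun x => f 0 * ind 0 x := (integrable_ind μ 0).const_mul _
  have hsum : μ.Integrable fun x =>
      ∑ i ∈ Finset.range n, c i * (ind (u (i + 1)) x - ind (u i) x) :=
    VectorMeasure.Integrable.fun_finsetSum _ fun i _ => hi _ _ _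
  have hmul : ∀ (c : ℝ) (g : I → ℝ), ∫ᵛ x, c * g x ∂•μ = c * ∫ᵛ x, g x ∂•μ := fun c g =>
    VectorMeasure.integral_fun_smul μ _ c g
  have hFz : F z = ∫ᵛ x, s x ∂•μ := by
    rw [hs, VectorMeasure.integral_fun_add hi0 hsum,
      VectorMeasure.integral_finsetSum _ fun i _ => hi _ _ _, hmul, integral_ind, hz, map_add,
      map_smul, map_sum, hμ, stieltjesMeasure_Icc, ← hμ, smul_eq_mul]
    congr 1
    refine Finset.sum_congr rfl fun i _ => ?_
    rw [hmul, VectorMeasure.integral_fun_sub (integrable_ind μ _) (integrable_ind μ _),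
      integral_ind, integral_ind, hμ, stieltjesMeasure_Icc, stieltjesMeasure_Icc, map_smul,
      map_sub, smul_eq_mul]
  have hsint : μ.Integrable s := hi0.add hsum
  have hfint : μ.Integrable f := SignedMeasure.integrable_continuousMap f
  have h1 : |∫ᵛ x, s x ∂•μ - ∫ᵛ x, f x ∂•μ| ≤ ε * μ.variation.real univ := by
    rw [← VectorMeasure.integral_fun_sub hsint hfint, ← Real.norm_eq_abs]
    refine (VectorMeasure.norm_integral_le_of_norm_le_const (C := ε)
      (.of_forall fun x => ?_)).trans ?_
    · rw [norm_sub_rev]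
      exact H x
    · have : ‖ContinuousLinearMap.lsmul ℝ ℝ (E := ℝ)‖ ≤ 1 :=
        ContinuousLinearMap.opNorm_lsmul_le
      gcongr
      exact mul_le_of_le_one_right hε.le this
  have h2 : |F (contX hB hC f) - F z| ≤ ε * (‖F‖ * ‖contX hB hC 1‖) := by
    rw [← map_sub, ← Real.norm_eq_abs]
    refine (F.le_opNorm _).trans ?_
    have h3 : ‖contX hB hC f - z‖ ≤ ‖contX hB hC (ε • 1)‖ := by
      refine ((represents_contX hB hC f).sub hzs).norm_le hp1
        (represents_contX hB hC (ε • 1)) (.of_forall fun x => ?_)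
      simpa [abs_of_pos hε] using H x
    rw [map_smul, norm_smul, Real.norm_of_nonneg hε.le] at h3
    calc _ ≤ ‖F‖ * (ε * ‖contX hB hC 1‖) := by gcongr
      _ = _ := by ring
  rw [hFz] at h2
  calc |F (contX hB hC f) - ∫ᵛ x, f x ∂•μ|
      ≤ |F (contX hB hC f) - ∫ᵛ x, s x ∂•μ| + |∫ᵛ x, s x ∂•μ - ∫ᵛ x, f x ∂•μ| :=
        abs_sub_le _ _ _
    _ ≤ ε * (‖F‖ * ‖contX hB hC 1‖) + ε * μ.variation.real univ := add_le_add h2 h1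
    _ = ε * K := by rw [hK]; ring

end Functional

/-- The map `F ↦ m_{g_F}`. -/
noncomputable def stieltjesMap : StrongDual ℝ (X p hB) →ₗ[ℝ] SignedMeasure I where
  toFun := stieltjesMeasure hp1 hB hC
  -- Linearity follows from uniqueness: both measures have the same integrals against continuous
  -- functions.
  map_add' F G := SignedMeasure.ext_of_forall_integral_eq fun f => by
    rw [VectorMeasure.integral_add_vectorMeasure (SignedMeasure.integrable_continuousMap f)
      (SignedMeasure.integrable_continuousMap f), ← apply_contX, ← apply_contX, ← apply_contX]
    rfl
  map_smul' c F := SignedMeasure.ext_of_forall_integral_eq fun f => by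
    rw [RingHom.id_apply, VectorMeasure.integral_smul_vectorMeasure, ← apply_contX, ← apply_contX]
    rfl

theorem stieltjesMap_injective : Function.Injective (stieltjesMap hp1 hB hC) := fun F G h => by
  refine ContinuousLinearMap.coeFn_injective
    ((denseRange_contX hB hC).equalizer F.continuous G.continuous (funext fun f => ?_))
  simp only [Function.comp_apply]
  rw [apply_contX hp1, apply_contX hp1]
  exact congrArg (fun μ : SignedMeasure I => ∫ᵛ x, f x ∂•μ) h

/-! ### The special variation as dual norm; surjectivity. -/

section SpecialVariation

variable {μ : SignedMeasure I}

theorem integral_le_specialVariation (h : specialVariation p μ < ∞) (f : C(I, ℝ)) :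
    ∫ᵛ x, f x ∂•μ ≤ (specialVariation p μ).toReal * ‖contX hB hC f‖ := by
  set S := (specialVariation p μ).toReal with hS
  -- Normalizing by `‖f‖ + δ` instead of `‖f‖` avoids dividing by zero.
  suffices H : ∀ δ : ℝ, 0 < δ → ∫ᵛ x, f x ∂•μ ≤ S * (‖contX hB hC f‖ + δ) by
    have hlim : Tendsto (fun δ : ℝ => S * (‖contX hB hC f‖ + δ)) (𝓝[>] 0)
        (𝓝 (S * (‖contX hB hC f‖ + 0))) := Continuous.continuousWithinAt (by fun_prop)
    rw [add_zero] at hlim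
    exact ge_of_tendsto hlim (eventually_mem_nhdsWithin.mono H)
  intro δ hδ
  set r := ‖contX hB hC f‖ + δ with hr
  have hr0 : 0 < r := by positivity
  have h1 : odeNorm p (ofCont (r⁻¹ • f)) ≤ 1 := by
    have : ‖contX hB hC (r⁻¹ • f)‖ ≤ 1 := by
      rw [map_smul, norm_smul, norm_inv, Real.norm_of_nonneg hr0.le, inv_mul_le_one₀ hr0]
      linarith
    exact this
  have h2 : ENNReal.ofReal (∫ᵛ x, (r⁻¹ • f) x ∂•μ) ≤ specialVariation p μ :=
    le_iSup₂_of_le (r⁻¹ • f) ⟨hC _, h1⟩ le_rfl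
  rw [ENNReal.ofReal_le_iff_le_toReal h.ne] at h2
  have h3 : ∫ᵛ x, (r⁻¹ • f) x ∂•μ = r⁻¹ * ∫ᵛ x, f x ∂•μ :=
    VectorMeasure.integral_fun_smul μ _ r⁻¹ f
  rwa [h3, inv_mul_le_iff₀ hr0, mul_comm] at h2

theorem norm_integral_le_specialVariation (h : specialVariation p μ < ∞) (f : C(I, ℝ)) :
    ‖∫ᵛ x, f x ∂•μ‖ ≤ (specialVariation p μ).toReal * ‖contX hB hC f‖ := by
  rw [Real.norm_eq_abs, abs_le']
  refine ⟨integral_le_specialVariation hB hC h f, ?_⟩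
  have := integral_le_specialVariation hB hC h (-f)
  rw [map_neg, norm_neg] at this
  exact (VectorMeasure.integral_fun_neg μ (ContinuousLinearMap.lsmul ℝ ℝ) f).symm.trans_le this

/-- The competitors lie in the unit ball of `X`, which gives one inequality; the bound they give on
continuous functions passes to `X` by density. -/
theorem specialVariation_eq {F : StrongDual ℝ (X p hB)}
    (hF : ∀ f, F (contX hB hC f) = ∫ᵛ x, f x ∂•μ) :
    ENNReal.ofReal ‖F‖ = specialVariation p μ := by
  have hle : specialVariation p μ ≤ ENNReal.ofReal ‖F‖ := by
    refine iSup₂_le fun f hf => ENNReal.ofReal_le_ofReal ?_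
    have h1 : ‖contX hB hC f‖ ≤ 1 := hf.2
    rw [← hF]
    calc F (contX hB hC f) ≤ ‖F‖ * ‖contX hB hC f‖ := (le_abs_self _).trans (F.le_opNorm _)
      _ ≤ ‖F‖ * 1 := by gcongr
      _ = ‖F‖ := mul_one _
  have hlt : specialVariation p μ < ∞ := hle.trans_lt ENNReal.ofReal_lt_top
  refine le_antisymm ?_ hle
  rw [ENNReal.ofReal_le_iff_le_toReal hlt.ne]
  refine F.opNorm_le_bound ENNReal.toReal_nonneg fun x => ?_
  refine (denseRange_contX hB hC).induction_on (p := fun x => ‖F x‖ ≤ _ * ‖x‖) x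
    (isClosed_le (by fun_prop) (by fun_prop)) fun f => ?_
  rw [hF]
  exact norm_integral_le_specialVariation hB hC hlt f

theorem exists_stieltjesMap_eq (h : specialVariation p μ < ∞) :
    ∃ F, stieltjesMap hp1 hB hC F = μ := by
  let L : C(I, ℝ) →ₗ[ℝ] ℝ :=
    { toFun := fun f => ∫ᵛ x, f x ∂•μ
      map_add' := fun f g => VectorMeasure.integral_fun_add
        (SignedMeasure.integrable_continuousMap f) (SignedMeasure.integrable_continuousMap g)
      map_smul' := fun c f => VectorMeasure.integral_fun_smul μ _ c f }
  -- The extension by density has a Stieltjes measure with the same integrals over `C[0,1]` as `μ`,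
  -- hence equal to `μ`.
  refine ⟨L.extendOfNorm (contX hB hC), SignedMeasure.ext_of_forall_integral_eq fun f => ?_⟩
  refine (apply_contX hp1 hB hC _ f).symm.trans ?_
  exact LinearMap.extendOfNorm_eq (denseRange_contX hB hC)
    ⟨_, norm_integral_le_specialVariation hB hC h⟩ f

end SpecialVariation

/-! ### A Borel representative serving all functionals. -/

section Representative

/-- Each continuous `k` with `|k| ≤ |h|` has `∫ k = F k ≤ ‖F‖ ‖k‖ ≤ ‖F‖ ‖h‖`. Thus norm-Cauchy
sequences in `C[0,1]` are Cauchy in `L¹` of every `|m_{g_F}|`. -/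
theorem integral_abs_stieltjesMeasure_le (F : StrongDual ℝ (X p hB)) (h : C(I, ℝ)) :
    ∫ x, |h x| ∂(stieltjesMeasure hp1 hB hC F).variation ≤ ‖F‖ * ‖contX hB hC h‖ := by
  refine SignedMeasure.integral_abs_variation_le fun k hk => ?_
  rw [← apply_contX]
  refine (le_abs_self _).trans ((F.le_opNorm _).trans ?_)
  gcongr
  exact norm_contX_le hB hC hp1 hk

theorem eLpNorm_stieltjesMeasure_le (F : StrongDual ℝ (X p hB)) (h : C(I, ℝ)) :
    eLpNorm h 1 (stieltjesMeasure hp1 hB hC F).variation ≤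
      ENNReal.ofReal (‖F‖ * ‖contX hB hC h‖) := by
  rw [eLpNorm_one_eq_lintegral_enorm,
    ← ofReal_integral_norm_eq_lintegral_enorm (SignedMeasure.integrable_continuousMap h)]
  exact ENNReal.ofReal_le_ofReal (integral_abs_stieltjesMeasure_le hp1 hB hC F h)

/-- Every element of `X` is the limit of a rapidly convergent sequence of continuous functions
which also converges almost everywhere. -/
theorem exists_seq_contX (hp1 : ∀ t, 1 < p t) (x : X p hB) : ∃ f : ℕ → C(I, ℝ),
    (∀ n, ‖contX hB hC (f n) - x‖ < (1 / 2) ^ n) ∧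
      ∀ᵐ t ∂volume, Tendsto (fun n => f n t) atTop (𝓝 (classOf p hB x t)) := by
  have hex : ∀ n : ℕ, ∃ f : C(I, ℝ), ‖contX hB hC f - x‖ < (1 / 2) ^ n := fun n => by
    obtain ⟨f, hf⟩ := Metric.denseRange_iff.1 (denseRange_contX hB hC) x ((1 / 2) ^ n)
      (by positivity)
    exact ⟨f, by rwa [dist_comm, dist_eq_norm] at hf⟩
  choose f hf using hex
  have hlim : Tendsto (fun n => contX hB hC (f n)) atTop (𝓝 x) := by
    rw [tendsto_iff_norm_sub_tendsto_zero]
    exact squeeze_zero (fun _ => norm_nonneg _) (fun n => (hf n).le)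
      (tendsto_pow_atTop_nhds_zero_of_lt_one (by norm_num) (by norm_num))
  obtain ⟨ns, hns, hae⟩ := (tendstoInMeasure_of_tendsto hp1
    ((continuous_subtype_val.tendsto _).comp hlim)).exists_seq_tendsto_ae
  -- A subsequence keeps the geometric rate, since `n ≤ ns n`.
  refine ⟨fun n => f (ns n), fun n => (hf _).trans_le ?_, ?_⟩
  · exact pow_le_pow_of_le_one (by norm_num) (by norm_num) (hns.id_le n)
  · have h1 : ∀ᵐ t ∂(volume : Measure I), ∀ n,
        toL0 p hB (contX hB hC (f n) : Space p hB) t = f n t :=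
      ae_all_iff.2 fun n => represents_contX hB hC (f n)
    filter_upwards [hae, h1] with t ht h1
    simp only [Function.comp_apply, h1] at ht
    exact ht

theorem exists_representative (x : X p hB) : ∃ y : I → ℝ, Measurable y ∧
    y =ᵐ[volume] classOf p hB x ∧ ∀ F, (stieltjesMeasure hp1 hB hC F).Integrable y ∧
      F x = ∫ᵛ t, y t ∂•stieltjesMeasure hp1 hB hC F := by
  obtain ⟨f, hf, hae⟩ := exists_seq_contX hB hC hp1 x
  -- The pointwise limit is fixed before `F` is introduced. Its default values, where the sequence
  -- diverges, fill a set that is null for Lebesgue measure and, as shown below, for every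
  -- `|m_{g_F}|`.
  refine ⟨fun t => limUnder atTop fun n => f n t, ?_, ?_, fun F => ?_⟩
  · exact (StronglyMeasurable.limUnder fun n => (f n).continuous.stronglyMeasurable).measurable
  · filter_upwards [hae] with t ht using ht.limUnder_eq
  set μ := stieltjesMeasure hp1 hB hC F with hμ
  set y : I → ℝ := fun t => limUnder atTop fun n => f n t with hy
  have hym : StronglyMeasurable y :=
    StronglyMeasurable.limUnder fun n => (f n).continuous.stronglyMeasurable
  -- The factor `2` comes from the triangle inequality through `x`; the `+ 1` makes the Cauchy bound
  -- strict even for `F = 0`.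
  set K : ℝ := (‖F‖ + 1) * 2 with hK
  set B : ℕ → ℝ≥0∞ := fun n => ENNReal.ofReal (K * (1 / 2) ^ n) with hBdef
  have hBsum : ∑' n, B n ≠ ∞ := by
    have hs : Summable fun n : ℕ => K * (1 / 2 : ℝ) ^ n := summable_geometric_two.mul_left K
    rw [← ENNReal.ofReal_tsum_of_nonneg (fun n => by positivity) hs]
    exact ENNReal.ofReal_ne_top
  have hm : ∀ n, AEStronglyMeasurable (f n) μ.variation := fun n =>
    (f n).continuous.aestronglyMeasurable
  have hcau : ∀ N n m : ℕ, N ≤ n → N ≤ m →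
      eLpNorm (⇑(f n) - ⇑(f m)) 1 μ.variation < B N := by
    intro N n m hn hm
    rw [← ContinuousMap.coe_sub]
    refine (eLpNorm_stieltjesMeasure_le hp1 hB hC F _).trans_lt ?_
    rw [ENNReal.ofReal_lt_ofReal_iff (by positivity), map_sub]
    have hpow : ∀ k, N ≤ k → ‖contX hB hC (f k) - x‖ < (1 / 2) ^ N := fun k hk =>
      (hf k).trans_le (pow_le_pow_of_le_one (by norm_num) (by norm_num) hk)
    have h1 : ‖contX hB hC (f n) - contX hB hC (f m)‖ ≤ 2 * (1 / 2) ^ N := by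
      rw [← sub_sub_sub_cancel_right _ _ x]
      refine (norm_sub_le _ _).trans ?_
      linarith [hpow n hn, hpow m hm]
    calc ‖F‖ * ‖contX hB hC (f n) - contX hB hC (f m)‖ ≤ ‖F‖ * (2 * (1 / 2) ^ N) := by gcongr
      _ < (‖F‖ + 1) * (2 * (1 / 2) ^ N) := by
          gcongr
          linarith
      _ = K * (1 / 2) ^ N := by rw [hK]; ring
  have hlim : ∀ᵐ t ∂μ.variation, Tendsto (fun n => f n t) atTop (𝓝 (y t)) := by
    filter_upwards [Lp.ae_tendsto_of_cauchy_eLpNorm hm le_rfl hBsum hcau] with t ht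
    exact tendsto_nhds_limUnder ht
  have hL1 := Lp.cauchy_tendsto_of_tendsto hm y hBsum hcau hlim
  have hint : ∀ n, μ.Integrable (f n) := fun n => SignedMeasure.integrable_continuousMap (f n)
  refine ⟨memLp_one_iff_integrable.1 (Lp.memLp_of_cauchy_tendsto le_rfl
    (fun n => memLp_one_iff_integrable.2 (hint n)) y hym.aestronglyMeasurable hL1), ?_⟩
  have h1 : Tendsto (fun n => ∫ᵛ t, f n t ∂•μ) atTop (𝓝 (∫ᵛ t, y t ∂•μ)) :=
    VectorMeasure.tendsto_integral_of_L1' y hym.aestronglyMeasurable (.of_forall hint) hL1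
  have h2 : Tendsto (fun n => contX hB hC (f n)) atTop (𝓝 x) := by
    rw [tendsto_iff_norm_sub_tendsto_zero]
    exact squeeze_zero (fun _ => norm_nonneg _) (fun n => (hf n).le)
      (tendsto_pow_atTop_nhds_zero_of_lt_one (by norm_num) (by norm_num))
  have h3 := (F.continuous.tendsto x).comp h2
  simp only [Function.comp_def, apply_contX hp1] at h3
  exact tendsto_nhds_unique h3 h1

end Representative

end OdeNorm

theorem theorem2p2 (p : I → ℝ) (hp : AEMeasurable p volume) (hp1 : ∀ t, 1 < p t)
    (hB : OdeNorm.IsBanach p) (hC : ∀ f : C(I, ℝ), OdeNorm.ofCont f ∈ OdeNorm.Lp p) :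
    ∃ (e : I → OdeNorm.X p hB) (m : StrongDual ℝ (OdeNorm.X p hB) →ₗ[ℝ] SignedMeasure I),
      -- `e t` is the element `1_{[0,t]}` of `X`
      (∀ t, OdeNorm.classOf p hB (e t) = OdeNorm.indicatorClass t) ∧
      -- `m F = m_g` with `g(t) = F(1_{[0,t]})`
      (∀ F, OdeNorm.IsStieltjes (fun t => F (e t)) (m F)) ∧
      -- `X^*` is identified with the Lebesgue–Stieltjes measures of finite special variation
      Function.Injective m ∧
      range m = {μ | (∃ g, OdeNorm.IsStieltjes g μ) ∧ OdeNorm.specialVariation p μ < ∞} ∧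
      -- the dual norm is the special variation
      (∀ F, ENNReal.ofReal ‖F‖ = OdeNorm.specialVariation p (m F)) ∧
      -- the pairing on continuous functions
      (∀ F (x : OdeNorm.X p hB) (f : C(I, ℝ)), OdeNorm.classOf p hB x = OdeNorm.ofCont f →
        F x = ∫ᵛ t, f t ∂•(m F)) ∧
      -- the pairing on all of `X`, through a representative that serves all functionals
      (∀ x : OdeNorm.X p hB, ∃ y : I → ℝ, Measurable y ∧ y =ᵐ[volume] OdeNorm.classOf p hB x ∧
        ∀ F, (m F).Integrable y ∧ F x = ∫ᵛ t, y t ∂•(m F)) := by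
  refine ⟨OdeNorm.indX hp1 hB hC, OdeNorm.stieltjesMap hp1 hB hC, fun t => rfl,
    fun F => ⟨OdeNorm.boundedVariationOn_apply_indX hp1 hB hC F, rfl⟩,
    OdeNorm.stieltjesMap_injective hp1 hB hC, ?_,
    fun F => OdeNorm.specialVariation_eq hB hC (OdeNorm.apply_contX hp1 hB hC F),
    fun F x f hx => ?_, OdeNorm.exists_representative hp1 hB hC⟩
  · ext μ
    refine ⟨?_, fun h => OdeNorm.exists_stieltjesMap_eq hp1 hB hC h.2⟩
    rintro ⟨F, rfl⟩
    refine ⟨⟨_, OdeNorm.boundedVariationOn_apply_indX hp1 hB hC F, rfl⟩, ?_⟩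
    exact (OdeNorm.specialVariation_eq hB hC (OdeNorm.apply_contX hp1 hB hC F)).symm.trans_lt
      ENNReal.ofReal_lt_top
  · have : x = OdeNorm.contX hB hC f := OdeNorm.classOf_injective hB hx
    rw [this]
    exact OdeNorm.apply_contX hp1 hB hC F f
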